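/- Let $k$ be a field and let $\mathcal C$ be a skeletally small, $\operatorname{Hom}$-finite, Krull-Schmidt triangulated $k$-category (with $k$-linear suspension functor $\Sigma$). Suppose that $\mathcal C$ has Serre duality, i.e. there is an autoequivalence $\nu\colon\mathcal C\to\mathcal C$ with $k$-linear isomorphisms $\operatorname{Hom}_{\mathcal C}(X,Y)\simeq \operatorname{Hom}_k(\operatorname{Hom}_{\mathcal C}(Y,\nu X),k)$ natural in $X$ and $Y$. Let $T$ be a rigid object of $\mathcal C$, i.e. $\operatorname{Hom}_{\mathcal C}(T,\Sigma T)=0$. Let $\mathcal X_T$ be the class of objects $X$ of $\mathcal C$ with $\operatorname{Hom}_{\mathcal C}(T,X)=0$, and let $\mathcal C/\mathcal X_T$ be the factor category, with the same objects as $\mathcal C$ and with morphisms those of $\mathcal C$ modulo the morphisms factoring through an object of $\mathcal X_T$. Let $\mathcal R$ be the class of regular morphisms in $\mathcal C/\mathcal X_T$, i.e. of those morphisms that are both monomorphisms and epimorphisms. Then $\mathcal R$ admits a calculus of left fractions and a calculus of right fractions. Furthermore, the localisation $(\mathcal C/\mathcal X_T)_{\mathcal R}$ of $\mathcal C/\mathcal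 X_T$ at $\mathcal R$ exists (as a category whose morphisms between any two objects form a set), and it is an abelian category, with an additive structure for which the localisation functor $\mathcal C/\mathcal X_T\to(\mathcal C/\mathcal X_T)_{\mathcal R}$ is additive. -/

import Mathlib

open CategoryTheory CategoryTheory.Limits

universe w v u v' u'

namespace RigidLocalization

/-- `C` is Krull-Schmidt: every object is a finite direct sum of objects whose endomorphism
rings are local. -/
def IsKrullSchmidt (C : Type u) [Category.{v} C] [Preadditive C] [HasFiniteBiproducts C] : Prop :=
  ∀ X : C, ∃ (n : ℕ) (Y : Fin n → C),
    (∀ i, IsLocalRing (End (Y i))) ∧ Nonempty (X ≅ ⨁ Y)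

/-- `C` is Hom-finite over `k`: all Hom spaces are finite dimensional. -/
def IsHomFinite (k : Type*) [Field k] (C : Type u) [Category.{v} C] [Preadditive C]
    [Linear k C] : Prop :=
  ∀ X Y : C, Module.Finite k (X ⟶ Y)

/-- A Serre duality on a `k`-linear category: an autoequivalence `ν` with isomorphisms
`Hom(X, Y) ≃ D Hom(Y, ν X)` natural in `X` and `Y`, where `D = Hom_k(-, k)`. -/
structure SerreDuality (k : Type*) [Field k] (C : Type u) [Category.{v} C] [Preadditive C]
    [Linear k C] where
  /-- the Serre autoequivalence -/
  ν : C ≌ C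
  /-- the duality isomorphism -/
  iso (X Y : C) : (X ⟶ Y) ≃ₗ[k] Module.Dual k (Y ⟶ ν.functor.obj X)
  /-- naturality in `X` -/
  naturality_left {X' X Y : C} (h : X' ⟶ X) (f : X ⟶ Y) (φ : Y ⟶ ν.functor.obj X') :
    iso X' Y (h ≫ f) φ = iso X Y f (φ ≫ ν.functor.map h)
  /-- naturality in `Y` -/
  naturality_right {X Y Y' : C} (f : X ⟶ Y) (g : Y ⟶ Y') (φ : Y' ⟶ ν.functor.obj X) :
    iso X Y' (f ≫ g) φ = iso X Y f (g ≫ φ)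

/-- `T` is rigid: `Ext¹(T, T) = Hom(T, Σ T) = 0`. -/
def IsRigid {C : Type u} [Category.{v} C] [Preadditive C] [HasShift C ℤ] (T : C) : Prop :=
  ∀ f : T ⟶ T⟦(1 : ℤ)⟧, f = 0

section Quotient

variable {C : Type u} [Category.{v} C] [Preadditive C]

/-- The class `𝒳_T` of objects `X` such that `Hom(T, X) = 0`. -/
def homVanishing (T : C) : ObjectProperty C :=
  fun X => ∀ f : T ⟶ X, f = 0

/-- Two parallel morphisms are related when their difference factors through an object of
`𝒳_T`. -/
def idealRel (T : C) : HomRel C :=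
  fun X Y f g => ∃ Z : C, homVanishing T Z ∧ ∃ (a : X ⟶ Z) (b : Z ⟶ Y), a ≫ b = f - g

lemma idealRel_add [HasBinaryBiproducts C] (T : C) ⦃X Y : C⦄ (f₁ f₂ g₁ g₂ : X ⟶ Y)
    (hf : idealRel T f₁ f₂) (hg : idealRel T g₁ g₂) :
    idealRel T (f₁ + g₁) (f₂ + g₂) := by
  obtain ⟨Z, hZ, a, b, h⟩ := hf
  obtain ⟨Z', hZ', a', b', h'⟩ := hg
  refine ⟨Z ⊞ Z', ?_, biprod.lift a a', biprod.desc b b', ?_⟩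
  · intro f
    apply biprod.hom_ext
    · rw [hZ (f ≫ biprod.fst), zero_comp]
    · rw [hZ' (f ≫ biprod.snd), zero_comp]
  · rw [biprod.lift_desc, h, h']
    abel

instance [HasZeroObject C] [HasBinaryBiproducts C] (T : C) : Congruence (idealRel T) where
  equivalence :=
    { refl := fun f =>
        let ⟨Z, hZ⟩ := HasZeroObject.zero (C := C)
        ⟨Z, fun g => hZ.eq_of_tgt g 0, 0, 0, by simp⟩
      symm := by
        rintro f g ⟨Z, hZ, a, b, h⟩
        exact ⟨Z, hZ, a, -b, by rw [Preadditive.comp_neg, h, neg_sub]⟩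
      trans := by
        intro f g h hfg hgh
        obtain ⟨Z, hZ, a, b, e⟩ := idealRel_add T f g g h hfg hgh
        exact ⟨Z, hZ, a, b, by rw [e]; abel⟩ }
  comp_left := by
    rintro X Y Z f g g' ⟨W, hW, a, b, h⟩
    exact ⟨W, hW, f ≫ a, b, by rw [Category.assoc, h, Preadditive.comp_sub]⟩
  comp_right := by
    rintro X Y Z f f' g ⟨W, hW, a, b, h⟩
    exact ⟨W, hW, a, b ≫ g, by rw [← Category.assoc, h, Preadditive.sub_comp]⟩

/-- The factor category `C/𝒳_T`: same objects as `C`, morphisms modulo those factoring through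
`𝒳_T`. -/
abbrev FactorCategory (T : C) := CategoryTheory.Quotient (idealRel T)

/-- The additive structure on `C/𝒳_T` induced by that of `C`. -/
instance [HasZeroObject C] [HasBinaryBiproducts C] (T : C) : Preadditive (FactorCategory T) :=
  CategoryTheory.Quotient.preadditive (idealRel T) (idealRel_add T)

end Quotient

/-- The class of regular morphisms of a category: those which are both monomorphisms and
epimorphisms. -/
def regularMorphisms (A : Type u) [Category.{v} A] : MorphismProperty A :=
  fun _ _ f => Mono f ∧ Epi f

end RigidLocalization

/-! Write `H` for `Hom(T, -)` from `C/𝒳_T` to finitely generated modules over `(End T)ᵐᵒᵖ`. Any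
localisation at the regular morphisms is equivalent to this module category, which is abelian
because `End T` is finite dimensional.

`H` is faithful: a morphism killed by `Hom(T, -)` factors through the cone of an approximation `Tⁿ ⟶
X`, and rigidity puts that cone in `𝒳_T`. `H` is dense: a module presentation is realised by a map
`Tᵐ ⟶ Tⁿ`, whose cone has the given module as its image. `H` need not be full, but every `X`
receives a morphism inverted by `H` from such a cone, out of which all module maps lift
(`exists_isPresented_isHomIso`, `IsPresented.exists_hom`). This gives right fractions for the
morphisms inverted by `H`, and full faithfulness after localising.

Serre duality makes the situation self-dual: `Hom(T, f)` is the transpose of `Hom(f, νT)`, and `νT`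
is rigid in `Cᵒᵖ`. Hence left fractions follow from right ones, and the regular morphisms are
exactly those inverted by `H`. -/

namespace RigidLocalization

open Pretriangulated

/-! ### Approximations by finite sums of copies of `T` -/

section Approximation

variable {C : Type u} [Category.{v} C] [Preadditive C]

/-- `s` induces a bijection on morphisms out of `T`. -/
def IsHomIso (T : C) {X Y : C} (s : X ⟶ Y) : Prop :=
  Function.Bijective (fun a : T ⟶ X => a ≫ s)

/-- Morphisms out of `T` are finitely generated under precomposition with `End T`. -/
def IsHomFinitelyGenerated (T : C) : Prop :=
  ∀ X : C, ∃ (n : ℕ) (a : Fin n → (T ⟶ X)), ∀ f : T ⟶ X, ∃ c : Fin n → (T ⟶ T),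
    f = ∑ i, c i ≫ a i

/-- The sum of `n` copies of `T`. -/
noncomputable abbrev power [HasFiniteBiproducts C] (T : C) (n : ℕ) : C := ⨁ fun _ : Fin n => T

lemma power_ext [HasFiniteBiproducts C] {T X : C} {n : ℕ} {f g : power T n ⟶ X}
    (h : ∀ t : T ⟶ power T n, t ≫ f = t ≫ g) : f = g :=
  biproduct.hom_ext' _ _ fun _ => h _

lemma comp_biproduct_desc_eq_sum [HasFiniteBiproducts C] {T X : C} {n : ℕ} (t : T ⟶ power T n)
    (g : Fin n → (T ⟶ X)) :
    t ≫ biproduct.desc g = ∑ i, (t ≫ biproduct.π _ i) ≫ g i := by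
  rw [biproduct.desc_eq, Preadditive.comp_sum]
  simp

/-- `Hom(T, Tⁿ)` is free on the inclusions, so an `End T`-linear map out of it is composition with a
morphism, determined by the images of the inclusions. -/
lemma exists_power_hom [HasFiniteBiproducts C] {T Y X : C} {n : ℕ} (y : power T n ⟶ Y)
    (φ : (T ⟶ Y) →+ (T ⟶ X)) (hφ : ∀ (e : T ⟶ T) (t : T ⟶ Y), φ (e ≫ t) = e ≫ φ t) :
    ∃ g : power T n ⟶ X, ∀ t : T ⟶ power T n, t ≫ g = φ (t ≫ y) := by
  refine ⟨biproduct.desc fun i => φ (biproduct.ι (fun _ : Fin n => T) i ≫ y), fun t => ?_⟩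
  rw [comp_biproduct_desc_eq_sum]
  simp_rw [← hφ]
  rw [← map_sum]
  congr 1
  simp_rw [← Category.assoc]
  rw [← Preadditive.sum_comp]
  congr 1
  simp_rw [Category.assoc]
  rw [← Preadditive.comp_sum, biproduct.total, Category.comp_id]

lemma IsHomFinitelyGenerated.exists_approximation [HasFiniteBiproducts C] {T : C}
    (h : IsHomFinitelyGenerated T) (X : C) :
    ∃ (n : ℕ) (p : power T n ⟶ X), ∀ f : T ⟶ X, ∃ g : T ⟶ power T n, f = g ≫ p := by
  obtain ⟨n, a, ha⟩ := h X
  refine ⟨n, biproduct.desc a, fun f => ?_⟩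
  obtain ⟨c, rfl⟩ := ha f
  exact ⟨biproduct.lift c, by simp [biproduct.lift_desc]⟩

variable [HasZeroObject C] [HasShift C ℤ] [∀ n : ℤ, (shiftFunctor C n).Additive] [Pretriangulated C]

lemma IsRigid.eq_zero_of_power {T : C} (hT : IsRigid T) {n : ℕ}
    (f : T ⟶ (power T n)⟦(1 : ℤ)⟧) : f = 0 := by
  rw [← Category.comp_id f, ← CategoryTheory.Functor.map_id, ← biproduct.total, Functor.map_sum,
    Preadditive.comp_sum]
  refine Finset.sum_eq_zero fun i _ => ?_
  rw [Functor.map_comp, ← Category.assoc, hT (f ≫ _), zero_comp]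

section Triangle

variable {X Y Z : C} {a : X ⟶ Y} {b : Y ⟶ Z} {c : Z ⟶ X⟦(1 : ℤ)⟧}

lemma comp_eq_zero_of_distTriang (h : Triangle.mk a b c ∈ distTriang C) : a ≫ b = 0 :=
  comp_distTriang_mor_zero₁₂ _ h

lemma exists_lift_of_distTriang (h : Triangle.mk a b c ∈ distTriang C) {W : C} (f : W ⟶ Y)
    (hf : f ≫ b = 0) : ∃ g : W ⟶ X, g ≫ a = f :=
  let ⟨g, hg⟩ := Triangle.coyoneda_exact₂ _ h f hf
  ⟨g, hg.symm⟩

lemma exists_desc_of_distTriang (h : Triangle.mk a b c ∈ distTriang C) {W : C} (f : Y ⟶ W)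
    (hf : a ≫ f = 0) : ∃ g : Z ⟶ W, b ≫ g = f :=
  let ⟨g, hg⟩ := Triangle.yoneda_exact₂ _ h f hf
  ⟨g, hg.symm⟩

lemma exists_lift_of_distTriang_of_isRigid {T : C} (hT : IsRigid T) {n : ℕ}
    {a : power T n ⟶ Y} {c : Z ⟶ (power T n)⟦(1 : ℤ)⟧}
    (h : Triangle.mk a b c ∈ distTriang C) (f : T ⟶ Z) : ∃ g : T ⟶ Y, g ≫ b = f :=
  let ⟨g, hg⟩ := Triangle.coyoneda_exact₃ _ h f (hT.eq_zero_of_power _)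
  ⟨g, hg.symm⟩

end Triangle

/-- A morphism killed by `Hom(T, -)` factors through an object of `𝒳_T`. -/
lemma exists_factorization_of_comp_eq_zero {T : C} (hT : IsRigid T)
    (hfg : IsHomFinitelyGenerated T) {X Y : C} (f : X ⟶ Y) (hf : ∀ t : T ⟶ X, t ≫ f = 0) :
    ∃ Z : C, homVanishing T Z ∧ ∃ (a : X ⟶ Z) (b : Z ⟶ Y), a ≫ b = f := by
  obtain ⟨n, p, hp⟩ := hfg.exists_approximation X
  -- A map `T ⟶ Z` lifts to `X` by rigidity, then through `p`, so it vanishes.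
  obtain ⟨Z, a, b, hZ⟩ := distinguished_cocone_triangle p
  obtain ⟨g, hg⟩ := exists_desc_of_distTriang hZ f
    (power_ext fun t => by rw [← Category.assoc, hf, comp_zero])
  refine ⟨Z, fun z => ?_, a, g, hg⟩
  obtain ⟨x, rfl⟩ := exists_lift_of_distTriang_of_isRigid hT hZ z
  obtain ⟨y, rfl⟩ := hp x
  rw [Category.assoc, comp_eq_zero_of_distTriang hZ, comp_zero]

/-- `Y` is the cone of a morphism between finite sums of copies of `T`. -/
def IsPresented (T Y : C) : Prop :=
  ∃ (m n : ℕ) (a : power T m ⟶ power T n) (b : power T n ⟶ Y) (c : Y ⟶ (power T m)⟦(1 : ℤ)⟧),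
    Triangle.mk a b c ∈ distTriang C

/-- Approximate `X` by `p`, then the fibre of `p` by `q`; `Y` is the cone of the composite and `p`
descends to `s`. Surjectivity comes from `p`. A kernel element lifts to `Tⁿ` by rigidity, then
through the fibre and `q`, so it dies in `Y`. -/
lemma exists_isPresented_isHomIso {T : C} (hT : IsRigid T) (hfg : IsHomFinitelyGenerated T)
    (X : C) : ∃ (Y : C) (s : Y ⟶ X), IsPresented T Y ∧ IsHomIso T s := by
  obtain ⟨n, p, hp⟩ := hfg.exists_approximation X
  obtain ⟨Z, i, d, hZ⟩ := distinguished_cocone_triangle₁ p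
  obtain ⟨m, q, hq⟩ := hfg.exists_approximation Z
  obtain ⟨Y, b, c, hY⟩ := distinguished_cocone_triangle (q ≫ i)
  obtain ⟨s, rfl⟩ := exists_desc_of_distTriang hY p
    (by rw [Category.assoc, comp_eq_zero_of_distTriang hZ, comp_zero])
  refine ⟨Y, s, ⟨m, n, _, b, c, hY⟩, ?_, ?_⟩
  · refine (injective_iff_map_eq_zero (Preadditive.rightComp T s)).2 fun y hy => ?_
    obtain ⟨t, rfl⟩ := exists_lift_of_distTriang_of_isRigid hT hY y
    obtain ⟨z, rfl⟩ := exists_lift_of_distTriang hZ t ((Category.assoc _ _ _).symm.trans hy)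
    obtain ⟨x, rfl⟩ := hq z
    rw [Category.assoc, Category.assoc, ← Category.assoc q, comp_eq_zero_of_distTriang hY,
      comp_zero]
  · intro f
    obtain ⟨g, rfl⟩ := hp f
    exact ⟨g ≫ b, Category.assoc _ _ _⟩

/-- Homomorphisms `Hom(T, Y) → Hom(T, X)` are induced by morphisms when `Y` is presented by `T`. -/
lemma IsPresented.exists_hom {T : C} (hT : IsRigid T) {Y X : C} (hY : IsPresented T Y)
    (φ : (T ⟶ Y) →+ (T ⟶ X)) (hφ : ∀ (e : T ⟶ T) (t : T ⟶ Y), φ (e ≫ t) = e ≫ φ t) :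
    ∃ h : Y ⟶ X, ∀ t : T ⟶ Y, t ≫ h = φ t := by
  obtain ⟨m, n, a, b, c, hY⟩ := hY
  obtain ⟨g, hg⟩ := exists_power_hom b φ hφ
  obtain ⟨h, rfl⟩ := exists_desc_of_distTriang hY g (power_ext fun t => by
    rw [← Category.assoc, hg, Category.assoc, comp_eq_zero_of_distTriang hY, comp_zero, map_zero,
      comp_zero])
  refine ⟨h, fun t => ?_⟩
  obtain ⟨t', rfl⟩ := exists_lift_of_distTriang_of_isRigid hT hY t
  rw [Category.assoc, hg]

/-- The Ore condition: `Hom(T, s)` can be inverted on modules, and the resulting module map is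
realised once `X` is replaced by a presented `X'`. -/
lemma exists_isHomIso_square {T : C} (hT : IsRigid T) (hfg : IsHomFinitelyGenerated T)
    {X Y Y' : C} (f : X ⟶ Y) (s : Y' ⟶ Y) (hs : IsHomIso T s) :
    ∃ (X' : C) (s' : X' ⟶ X) (f' : X' ⟶ Y'), IsHomIso T s' ∧
      ∀ t : T ⟶ X', t ≫ s' ≫ f = t ≫ f' ≫ s := by
  obtain ⟨X', s', hX', hs'⟩ := exists_isPresented_isHomIso hT hfg X
  let e : (T ⟶ Y') ≃+ (T ⟶ Y) := AddEquiv.ofBijective (Preadditive.rightComp T s) hs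
  have he (t) : e.symm t ≫ s = t := e.apply_symm_apply t
  obtain ⟨f', hf'⟩ := hX'.exists_hom hT
    (e.symm.toAddMonoidHom.comp (Preadditive.rightComp T (s' ≫ f))) (fun d t => by
      refine hs.1 ?_
      change e.symm ((d ≫ t) ≫ s' ≫ f) ≫ s = (d ≫ e.symm (t ≫ s' ≫ f)) ≫ s
      rw [he, Category.assoc, Category.assoc, he])
  refine ⟨X', s', f', hs', fun t => ?_⟩
  rw [← Category.assoc t f' s, hf']
  exact (he _).symm

end Approximation

/-! ### Serre duality and passage to the opposite category -/

section Serre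

variable {k : Type w} [Field k] {C : Type u} [Category.{v} C] [Preadditive C] [Linear k C]

lemma IsHomFinite.isHomFinitelyGenerated (h : IsHomFinite k C) (T : C) :
    IsHomFinitelyGenerated T := by
  intro X
  have := h T X
  obtain ⟨n, a, ha⟩ := Module.Finite.exists_fin (R := k) (M := T ⟶ X)
  refine ⟨n, a, fun f => ?_⟩
  obtain ⟨c, rfl⟩ := (Submodule.mem_span_range_iff_exists_fun k).1
    (ha ▸ Submodule.mem_top : f ∈ Submodule.span k (Set.range a))
  exact ⟨fun i => c i • 𝟙 T, by simp⟩

lemma IsHomFinite.isHomFinitelyGenerated_op (h : IsHomFinite k C) (T : C) :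
    IsHomFinitelyGenerated (Opposite.op T) := by
  intro X
  have := h X.unop T
  obtain ⟨n, a, ha⟩ := Module.Finite.exists_fin (R := k) (M := X.unop ⟶ T)
  refine ⟨n, fun i => (a i).op, fun f => ?_⟩
  obtain ⟨c, hc⟩ := (Submodule.mem_span_range_iff_exists_fun k).1
    (ha ▸ Submodule.mem_top : f.unop ∈ Submodule.span k (Set.range a))
  refine ⟨fun i => (c i • 𝟙 T).op, Quiver.Hom.unop_inj ?_⟩
  rw [← hc, unop_sum]
  simp

namespace SerreDuality

variable (S : SerreDuality k C) (T : C)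

lemma comp_eq_zero_iff {X Y : C} (f : X ⟶ Y) :
    (∀ t : T ⟶ X, t ≫ f = 0) ↔ ∀ t : Y ⟶ S.ν.functor.obj T, f ≫ t = 0 := by
  constructor
  · intro h t
    rw [← Module.forall_dual_apply_eq_zero_iff k]
    intro ψ
    obtain ⟨g, rfl⟩ := (S.iso T X).surjective ψ
    rw [← S.naturality_right, h, map_zero, LinearMap.zero_apply]
  · intro h t
    refine (S.iso T Y).injective (LinearMap.ext fun φ => ?_)
    rw [S.naturality_right, h, map_zero, map_zero, LinearMap.zero_apply]

/-- Transposition over a field exchanges injectivity and surjectivity, which yields the next two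
lemmas. -/
lemma iso_comp_rightComp {X Y : C} (f : X ⟶ Y) :
    (S.iso T Y).toLinearMap ∘ₗ Linear.rightComp k T f =
      (Linear.leftComp k (S.ν.functor.obj T) f).dualMap ∘ₗ (S.iso T X).toLinearMap := by
  ext t φ
  exact S.naturality_right t f φ

lemma surjective_comp_iff {X Y : C} (f : X ⟶ Y) :
    Function.Surjective (fun t : T ⟶ X => t ≫ f) ↔
      Function.Injective (fun t : Y ⟶ S.ν.functor.obj T => f ≫ t) := by
  have key := congrArg DFunLike.coe (S.iso_comp_rightComp T f)
  rw [LinearMap.coe_comp, LinearMap.coe_comp] at key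
  refine Iff.trans ?_ (LinearMap.dualMap_surjective_iff
    (f := Linear.leftComp k (S.ν.functor.obj T) f))
  rw [← (S.iso T X).surjective.of_comp_iff, ← (S.iso T Y).toEquiv.comp_surjective]
  exact iff_of_eq (congrArg Function.Surjective key)

lemma injective_comp_iff {X Y : C} (f : X ⟶ Y) :
    Function.Injective (fun t : T ⟶ X => t ≫ f) ↔
      Function.Surjective (fun t : Y ⟶ S.ν.functor.obj T => f ≫ t) := by
  have key := congrArg DFunLike.coe (S.iso_comp_rightComp T f)
  rw [LinearMap.coe_comp, LinearMap.coe_comp] at key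
  refine Iff.trans ?_ (LinearMap.dualMap_injective_iff
    (f := Linear.leftComp k (S.ν.functor.obj T) f))
  rw [← (S.iso T X).toEquiv.injective_comp, ← (S.iso T Y).toEquiv.comp_injective]
  exact iff_of_eq (congrArg Function.Injective key)

lemma isHomIso_iff {X Y : C} (f : X ⟶ Y) :
    IsHomIso T f ↔ IsHomIso (Opposite.op (S.ν.functor.obj T)) f.op := by
  have h : (fun t : Opposite.op (S.ν.functor.obj T) ⟶ Opposite.op Y => t ≫ f.op) =
      (opEquiv _ _).symm ∘ (fun t : Y ⟶ S.ν.functor.obj T => f ≫ t) ∘ opEquiv _ _ := rfl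
  rw [IsHomIso, IsHomIso, h, Equiv.comp_bijective, Equiv.bijective_comp, Function.Bijective,
    Function.Bijective, S.injective_comp_iff, S.surjective_comp_iff, and_comm]

lemma eq_zero_of_forall_eq_zero {X Y : C} (h : ∀ f : X ⟶ Y, f = 0)
    (g : Y ⟶ S.ν.functor.obj X) : g = 0 := by
  rw [← Module.forall_dual_apply_eq_zero_iff k]
  intro ψ
  obtain ⟨f, rfl⟩ := (S.iso X Y).surjective ψ
  rw [h f, map_zero, LinearMap.zero_apply]

-- Duality applied twice, with a shift in between: `Hom(T, ΣT) = 0` gives `Hom(ΣT, νT) = 0`, so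
-- `Hom(T, Σ⁻¹νT) = 0`, so `Hom(Σ⁻¹νT, νT) = 0`. No compatibility of `ν` with `Σ` is needed.
open Pretriangulated.Opposite in
lemma isRigid_op [HasZeroObject C] [HasShift C ℤ] [∀ n : ℤ, (shiftFunctor C n).Additive]
    [Pretriangulated C] (hT : IsRigid T) :
    IsRigid (Opposite.op (S.ν.functor.obj T)) := by
  intro f
  have h (x : T ⟶ (S.ν.functor.obj T)⟦(-1 : ℤ)⟧) : x = 0 := by
    have e := (shiftFunctorCompIsoId C (-1 : ℤ) 1 (by simp)).app (S.ν.functor.obj T)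
    rw [← (shiftFunctor C (1 : ℤ)).map_eq_zero_iff]
    exact (cancel_mono e.hom).1
      ((S.eq_zero_of_forall_eq_zero hT (x⟦(1 : ℤ)⟧' ≫ e.hom)).trans zero_comp.symm)
  rw [← cancel_mono ((shiftFunctorOpIso C 1 (-1) (by simp)).hom.app _), zero_comp]
  exact Quiver.Hom.unop_inj (S.eq_zero_of_forall_eq_zero h _)

end SerreDuality

/-- The dual of `exists_isHomIso_square`, obtained by applying it to `ν T` in `Cᵒᵖ`. -/
lemma SerreDuality.exists_isHomIso_square (S : SerreDuality k C) {T : C} [HasZeroObject C] [HasShift C ℤ]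
    [∀ n : ℤ, (shiftFunctor C n).Additive] [Pretriangulated C] (hfin : IsHomFinite k C)
    (hT : IsRigid T) {X X' Y : C} (f : X' ⟶ Y) (s : X' ⟶ X) (hs : IsHomIso T s) :
    ∃ (Y' : C) (s' : Y ⟶ Y') (f' : X ⟶ Y'), IsHomIso T s' ∧
      ∀ t : T ⟶ X', t ≫ f ≫ s' = t ≫ s ≫ f' := by
  open Pretriangulated.Opposite in
  obtain ⟨Y', s', f', hs', h⟩ := RigidLocalization.exists_isHomIso_square (S.isRigid_op T hT)
    (hfin.isHomFinitelyGenerated_op _) f.op s.op ((S.isHomIso_iff T s).1 hs)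
  refine ⟨Y'.unop, s'.unop, f'.unop, (S.isHomIso_iff T _).2 hs', fun t => ?_⟩
  -- The opposite square commutes when tested against `νT`; `comp_eq_zero_iff` turns this into
  -- testing against `T`.
  rw [← sub_eq_zero, ← Preadditive.comp_sub]
  revert t
  rw [S.comp_eq_zero_iff]
  intro t
  rw [Preadditive.sub_comp, sub_eq_zero]
  exact Quiver.Hom.op_inj (h t.op)

end Serre

/-! ### Localisation at the morphisms inverted by a faithful functor -/

section FaithfulLocalization

variable {A : Type*} [Category* A] {M : Type*} [Category* M]

/-- Every object `X` admits a morphism `Y ⟶ X` inverted by `H`, where all morphisms out of `H Y`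
lift to morphisms out of `Y`. -/
def HasLiftableCovers (H : A ⥤ M) : Prop :=
  ∀ X : A, ∃ (Y : A) (s : Y ⟶ X), IsIso (H.map s) ∧
    ∀ (Z : A) (φ : H.obj Y ⟶ H.obj Z), ∃ f : Y ⟶ Z, H.map f = φ

variable (H : A ⥤ M) {W : MorphismProperty A} [W.HasRightCalculusOfFractions]
  {D : Type*} [Category* D] (L : A ⥤ D) [L.IsLocalization W]

-- Lifting the inverse of `H.map ψ.s` gives a section of the denominator, by faithfulness, so the
-- fraction is an honest morphism.
include W in
lemma exists_map_eq_of_liftable [H.Faithful] (hW : W.IsInvertedBy H) {Y : A}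
    (hY : ∀ (Z : A) (φ : H.obj Y ⟶ H.obj Z), ∃ f : Y ⟶ Z, H.map f = φ) {Z : A}
    (g : L.obj Y ⟶ L.obj Z) : ∃ f : Y ⟶ Z, L.map f = g := by
  obtain ⟨ψ, rfl⟩ := Localization.exists_rightFraction L W g
  have := hW _ ψ.hs
  obtain ⟨r, hr⟩ := hY _ (inv (H.map ψ.s))
  have h : r ≫ ψ.s = 𝟙 Y := H.map_injective (by simp [hr])
  exact ⟨r ≫ ψ.f, by
    rw [L.map_comp, ← ψ.map_s_comp_map L (Localization.inverts L W), ← Category.assoc,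
      ← L.map_comp, h, L.map_id, Category.id_comp]⟩

variable [H.Faithful] (hW : ∀ ⦃X Y : A⦄ (f : X ⟶ Y), W f ↔ IsIso (H.map f))
  (hH : HasLiftableCovers H)

include hW hH

omit [W.HasRightCalculusOfFractions] [H.Faithful] in
/-- The objects of a localization come from sources of liftable morphisms. -/
lemma exists_iso_of_hasLiftableCovers (d : D) :
    ∃ (Y : A) (_ : L.obj Y ≅ d), ∀ (Z : A) (φ : H.obj Y ⟶ H.obj Z), ∃ f : Y ⟶ Z, H.map f = φ := by
  have := Localization.essSurj L W
  obtain ⟨Y, s, hs, hY⟩ := hH (L.objPreimage d)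
  have := Localization.inverts L W s ((hW s).2 hs)
  exact ⟨Y, asIso (L.map s) ≪≫ L.objObjPreimageIso d, hY⟩

variable (G : D ⥤ M) (e : L ⋙ G ≅ H)
include e

lemma faithful_of_hasLiftableCovers : G.Faithful where
  map_injective {d d'} f g hfg := by
    obtain ⟨Y, i, hY⟩ := exists_iso_of_hasLiftableCovers H L hW hH d
    obtain ⟨Z, j, -⟩ := exists_iso_of_hasLiftableCovers H L hW hH d'
    have hW' : W.IsInvertedBy H := fun _ _ f hf => (hW f).1 hf
    obtain ⟨f', hf⟩ := exists_map_eq_of_liftable H L hW' hY (i.hom ≫ f ≫ j.inv)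
    obtain ⟨g', hg⟩ := exists_map_eq_of_liftable H L hW' hY (i.hom ≫ g ≫ j.inv)
    have h : f' = g' := H.map_injective (by
      rw [← cancel_epi (e.hom.app Y), ← e.hom.naturality, ← e.hom.naturality,
        Functor.comp_map, Functor.comp_map, hf, hg]
      simp [hfg])
    rw [h, hg] at hf
    simpa using hf.symm

omit [W.HasRightCalculusOfFractions] [H.Faithful] in
lemma full_of_hasLiftableCovers : G.Full where
  map_surjective {d d'} φ := by
    obtain ⟨Y, i, hY⟩ := exists_iso_of_hasLiftableCovers H L hW hH d
    obtain ⟨Z, j, -⟩ := exists_iso_of_hasLiftableCovers H L hW hH d'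
    obtain ⟨f, hf⟩ := hY Z (e.inv.app Y ≫ G.map i.hom ≫ φ ≫ G.map j.inv ≫ e.hom.app Z)
    have hf' : G.map (L.map f) = G.map i.hom ≫ φ ≫ G.map j.inv := by
      rw [← cancel_mono (e.hom.app Z)]
      have := e.hom.naturality f
      rw [Functor.comp_map] at this
      rw [this, hf]
      simp
    exact ⟨i.inv ≫ L.map f ≫ j.hom, by simp [hf']⟩

omit hW e in
lemma isEquivalence_of_hasLiftableCovers [H.EssSurj]
    (hW : ∀ ⦃X Y : A⦄ (f : X ⟶ Y), W f ↔ IsIso (H.map f)) (e : L ⋙ G ≅ H) : G.IsEquivalence where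
  faithful := faithful_of_hasLiftableCovers H L hW hH G e
  full := full_of_hasLiftableCovers H L hW hH G e
  essSurj := ⟨fun m => ⟨L.obj (H.objPreimage m),
    ⟨e.app _ ≪≫ H.objObjPreimageIso m⟩⟩⟩

end FaithfulLocalization

/-! ### The functor `Hom(T, -)` to finitely generated modules -/

section HomFunctor

variable {C : Type u} [Category.{v} C] [Preadditive C]

lemma IsHomFinitelyGenerated.module_finite {T : C} (h : IsHomFinitelyGenerated T) (X : C) :
    Module.Finite (End T)ᵐᵒᵖ (T ⟶ X) := by
  obtain ⟨n, a, ha⟩ := h X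
  refine Module.Finite.of_surjective (Fintype.linearCombination (End T)ᵐᵒᵖ a) fun f => ?_
  obtain ⟨c, rfl⟩ := ha f
  exact ⟨fun i => MulOpposite.op (c i), Fintype.linearCombination_apply _ _ _⟩

lemma IsHomFinite.isNoetherianRing {k : Type w} [Field k] [Linear k C] (h : IsHomFinite k C)
    (T : C) : IsNoetherianRing (End T)ᵐᵒᵖ := by
  have : Module.Finite k (End T) := h T T
  have : Module.Finite k (End T)ᵐᵒᵖ := Module.Finite.equiv (MulOpposite.opLinearEquiv k)
  exact isNoetherian_of_tower k inferInstance

/-- The functor `Hom(T, -)` on `C/𝒳_T`, with values in finitely generated `End T`-modules. -/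
noncomputable def homFunctor {T : C} (h : IsHomFinitelyGenerated T) :
    FactorCategory T ⥤ FGModuleCat.{v} (End T)ᵐᵒᵖ :=
  CategoryTheory.Quotient.lift (idealRel T)
    ((ModuleCat.isFG (End T)ᵐᵒᵖ).lift (preadditiveCoyonedaObj T)
      fun X => h.module_finite X) (by
    rintro X Y f g ⟨Z, hZ, a, b, hab⟩
    refine ObjectProperty.hom_ext _ (ModuleCat.hom_ext (LinearMap.ext fun (t : T ⟶ X) => ?_))
    change t ≫ f = t ≫ g
    rw [← sub_eq_zero, ← Preadditive.comp_sub, ← hab, ← Category.assoc, hZ (t ≫ a), zero_comp])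

/-- The projection `C ⥤ C/𝒳_T`. -/
abbrev factor (T : C) : C ⥤ FactorCategory T := CategoryTheory.Quotient.functor (idealRel T)

variable {T : C} (h : IsHomFinitelyGenerated T)

lemma isIso_homFunctor_map_iff {X Y : C} (f : X ⟶ Y) :
    IsIso ((homFunctor h).map ((factor T).map f)) ↔ IsHomIso T f := by
  rw [← isIso_iff_of_reflects_iso _ (forget₂ (FGModuleCat (End T)ᵐᵒᵖ) (ModuleCat (End T)ᵐᵒᵖ)),
    ConcreteCategory.isIso_iff_bijective]
  rfl

include h

variable [HasZeroObject C] [HasShift C ℤ] [∀ n : ℤ, (shiftFunctor C n).Additive] [Pretriangulated C]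

lemma factor_map_eq_iff (hT : IsRigid T) {X Y : C} (f g : X ⟶ Y) :
    (factor T).map f = (factor T).map g ↔ ∀ t : T ⟶ X, t ≫ f = t ≫ g := by
  refine ⟨fun e t => ?_, fun e => ?_⟩
  · exact congrArg (fun m => ((homFunctor h).map m).hom.hom t) e
  · refine CategoryTheory.Quotient.sound _ (exists_factorization_of_comp_eq_zero hT h (f - g)
      fun t => ?_)
    rw [Preadditive.comp_sub, e, sub_self]

lemma homFunctor_faithful (hT : IsRigid T) : (homFunctor h).Faithful where
  map_injective {X Y} f g e := by
    obtain ⟨f, rfl⟩ := (factor T).map_surjective f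
    obtain ⟨g, rfl⟩ := (factor T).map_surjective g
    exact (factor_map_eq_iff h hT f g).2 fun t => congrArg (fun m => m.hom.hom t) e

/-- The projection to `C/𝒳_T` is injective on morphisms out of `T`. -/
lemma eq_of_factor_map_eq (hT : IsRigid T) {X : C} {f g : T ⟶ X}
    (e : (factor T).map f = (factor T).map g) : f = g := by
  simpa using (factor_map_eq_iff h hT f g).1 e (𝟙 T)

lemma hasLiftableCovers_homFunctor (hT : IsRigid T) : HasLiftableCovers (homFunctor h) := by
  rintro ⟨X⟩
  obtain ⟨Y, s, hY, hs⟩ := exists_isPresented_isHomIso hT h X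
  refine ⟨⟨Y⟩, (factor T).map s, (isIso_homFunctor_map_iff h s).2 hs, ?_⟩
  rintro ⟨Z⟩ φ
  obtain ⟨f, hf⟩ := hY.exists_hom hT φ.hom.hom.toAddMonoidHom
    fun e t => φ.hom.hom.map_smul (MulOpposite.op e) t
  exact ⟨(factor T).map f, ObjectProperty.hom_ext _ (ModuleCat.hom_ext (LinearMap.ext hf))⟩

omit h [HasZeroObject C] [HasShift C ℤ] [∀ n : ℤ, (shiftFunctor C n).Additive]
  [Pretriangulated C] in
lemma exists_surjective_linearMap [HasFiniteBiproducts C] (T : C) (M : Type*) [AddCommGroup M]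
    [Module (End T)ᵐᵒᵖ M] [Module.Finite (End T)ᵐᵒᵖ M] :
    ∃ (n : ℕ) (q : (T ⟶ power T n) →ₗ[(End T)ᵐᵒᵖ] M), Function.Surjective q := by
  obtain ⟨n, f, hf⟩ := Module.Finite.exists_fin' (End T)ᵐᵒᵖ M
  let p (i : Fin n) : (T ⟶ power T n) →ₗ[(End T)ᵐᵒᵖ] (End T)ᵐᵒᵖ :=
    { toFun t := MulOpposite.op (t ≫ biproduct.π (fun _ => T) i : T ⟶ T)
      map_add' s t := by rw [Preadditive.add_comp]; rfl
      map_smul' e t := congrArg MulOpposite.op (Category.assoc e.unop t _) }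
  refine ⟨n, f ∘ₗ LinearMap.pi p, hf.comp fun c => ⟨biproduct.lift fun i => (c i).unop, ?_⟩⟩
  ext i
  exact congrArg MulOpposite.op (biproduct.lift_π (fun i => (c i).unop) i)

lemma homFunctor_essSurj [IsNoetherianRing (End T)ᵐᵒᵖ] (hT : IsRigid T) :
    (homFunctor h).EssSurj where
  mem_essImage M := by
    have : Module.Finite (End T)ᵐᵒᵖ M.obj := M.property
    obtain ⟨n, q, hq⟩ := exists_surjective_linearMap T M.obj
    -- With the Noetherian hypothesis, this makes the kernel of `q` finitely generated; the cone of
    -- `a` then realises the presentation.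
    have := h.module_finite (power T n)
    obtain ⟨m, r, hr⟩ := exists_surjective_linearMap T (LinearMap.ker q)
    obtain ⟨a, ha⟩ := exists_power_hom (𝟙 (power T m))
      ((LinearMap.ker q).subtype ∘ₗ r).toAddMonoidHom
      fun e t => ((LinearMap.ker q).subtype ∘ₗ r).map_smul (MulOpposite.op e) t
    obtain ⟨Y, b, c, hY⟩ := distinguished_cocone_triangle a
    let β : (T ⟶ power T n) →ₗ[(End T)ᵐᵒᵖ] (T ⟶ Y) := ((preadditiveCoyonedaObj T).map b).hom
    have hβ : Function.Surjective β := exists_lift_of_distTriang_of_isRigid hT hY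
    have hker : LinearMap.ker β = LinearMap.ker q := by
      ext t
      constructor
      · intro ht
        obtain ⟨t', rfl⟩ := exists_lift_of_distTriang hY t ht
        rw [ha]
        exact (r _).2
      · intro ht
        obtain ⟨t', ht'⟩ := hr ⟨t, ht⟩
        have : t' ≫ a = t := by
          rw [ha, Category.comp_id]
          exact congrArg Subtype.val ht'
        change t ≫ b = 0
        rw [← this, Category.assoc, comp_eq_zero_of_distTriang hY, comp_zero]
    exact ⟨(factor T).obj Y, ⟨(ModuleCat.isFG _).isoMk
      ((β.quotKerEquivOfSurjective hβ).symm.trans ((Submodule.quotEquivOfEq _ _ hker).trans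
        (q.quotKerEquivOfSurjective hq))).toModuleIso⟩⟩

end HomFunctor

/-! ### Regular morphisms and their localisation -/

section Regular

variable {k : Type w} [Field k] {C : Type u} [Category.{v} C] [Preadditive C] [HasZeroObject C]
  [HasShift C ℤ] [∀ n : ℤ, (shiftFunctor C n).Additive] [Pretriangulated C] [Linear k C]
  (hfin : IsHomFinite k C) (S : SerreDuality k C) {T : C} (hT : IsRigid T)

include hfin S hT

/-- The regular morphisms of `C/𝒳_T` are those inverted by `Hom(T, -)`. -/
lemma regularMorphisms_factor_map_iff {X Y : C} (f : X ⟶ Y) :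
    regularMorphisms (FactorCategory T) ((factor T).map f) ↔ IsHomIso T f := by
  have h := hfin.isHomFinitelyGenerated T
  constructor
  · rintro ⟨_, _⟩
    refine ⟨fun a b hab => eq_of_factor_map_eq h hT ?_,
      (S.surjective_comp_iff T f).2 fun a b hab => ?_⟩
    · rw [← cancel_mono ((factor T).map f), ← Functor.map_comp, ← Functor.map_comp]
      exact congrArg _ hab
    · have e : (factor T).map a = (factor T).map b := by
        rw [← cancel_epi ((factor T).map f), ← Functor.map_comp, ← Functor.map_comp]
        exact congrArg _ hab
      rw [factor_map_eq_iff h hT] at e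
      -- `a - b` is killed by `Hom(T, -)`, hence by composition with any endomorphism of `νT`; the
      -- identity gives `a = b`.
      have e' := (S.comp_eq_zero_iff T (a - b)).1
        (fun t => by rw [Preadditive.comp_sub, e, sub_self]) (𝟙 _)
      rwa [Category.comp_id, sub_eq_zero] at e'
  · intro hf
    have := homFunctor_faithful h hT
    have := (isIso_homFunctor_map_iff h f).2 hf
    exact ⟨(homFunctor h).mono_of_mono_map inferInstance,
      (homFunctor h).epi_of_epi_map inferInstance⟩

lemma regularMorphisms_iff_isIso_map {X Y : FactorCategory T} (f : X ⟶ Y) :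
    regularMorphisms (FactorCategory T) f ↔
      IsIso ((homFunctor (hfin.isHomFinitelyGenerated T)).map f) := by
  obtain ⟨f, rfl⟩ := (factor T).map_surjective f
  rw [regularMorphisms_factor_map_iff hfin S hT, isIso_homFunctor_map_iff]

omit hfin S hT [HasZeroObject C] [HasShift C ℤ] [∀ n : ℤ, (shiftFunctor C n).Additive]
  [Pretriangulated C] [Preadditive C] [Linear k C] in
lemma regularMorphisms_isMultiplicative : (regularMorphisms C).IsMultiplicative where
  id_mem _ := ⟨inferInstance, inferInstance⟩
  comp_mem _ _ hf hg :=
    have := hf.1; have := hf.2; have := hg.1; have := hg.2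
    ⟨mono_comp _ _, epi_comp _ _⟩

lemma regularMorphisms_hasLeftCalculusOfFractions :
    (regularMorphisms (FactorCategory T)).HasLeftCalculusOfFractions where
  toIsMultiplicative := regularMorphisms_isMultiplicative
  exists_leftFraction := by
    rintro ⟨X⟩ ⟨Y⟩ ⟨s, hs, f⟩
    obtain ⟨s, rfl⟩ := (factor T).map_surjective s
    obtain ⟨f, rfl⟩ := (factor T).map_surjective f
    obtain ⟨Y', s', f', hs', e⟩ := S.exists_isHomIso_square hfin hT f s
      ((regularMorphisms_factor_map_iff hfin S hT s).1 hs)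
    refine ⟨⟨(factor T).map f', (factor T).map s',
      (regularMorphisms_factor_map_iff hfin S hT s').2 hs'⟩, ?_⟩
    exact (factor_map_eq_iff (hfin.isHomFinitelyGenerated T) hT _ _).2 e
  ext _ _ Y f₁ f₂ s hs e :=
    have := hs.2
    ⟨Y, 𝟙 Y, ⟨inferInstance, inferInstance⟩, by rw [(cancel_epi s).1 e]⟩

lemma regularMorphisms_hasRightCalculusOfFractions :
    (regularMorphisms (FactorCategory T)).HasRightCalculusOfFractions where
  toIsMultiplicative := regularMorphisms_isMultiplicative
  exists_rightFraction := by
    rintro ⟨X⟩ ⟨Y⟩ ⟨f, s, hs⟩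
    obtain ⟨s, rfl⟩ := (factor T).map_surjective s
    obtain ⟨f, rfl⟩ := (factor T).map_surjective f
    obtain ⟨X', s', f', hs', e⟩ := exists_isHomIso_square hT (hfin.isHomFinitelyGenerated T) f s
      ((regularMorphisms_factor_map_iff hfin S hT s).1 hs)
    refine ⟨⟨(factor T).map s', (regularMorphisms_factor_map_iff hfin S hT s').2 hs',
      (factor T).map f'⟩, ?_⟩
    exact (factor_map_eq_iff (hfin.isHomFinitelyGenerated T) hT _ _).2 e
  ext X _ _ f₁ f₂ s hs e :=
    have := hs.1
    ⟨X, 𝟙 X, ⟨inferInstance, inferInstance⟩, by rw [(cancel_mono s).1 e]⟩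

/-- Any localization of `C/𝒳_T` at the regular morphisms is equivalent to the category of finitely
generated `End T`-modules. -/
lemma exists_isEquivalence_fgModuleCat {D : Type*} [Category* D] (L : FactorCategory T ⥤ D)
    [L.IsLocalization (regularMorphisms (FactorCategory T))] :
    ∃ G : D ⥤ FGModuleCat.{v} (End T)ᵐᵒᵖ, G.IsEquivalence := by
  have h := hfin.isHomFinitelyGenerated T
  have := hfin.isNoetherianRing T
  have := regularMorphisms_hasRightCalculusOfFractions hfin S hT
  have := homFunctor_faithful h hT
  have := homFunctor_essSurj h hT
  have hW ⦃X Y : FactorCategory T⦄ (f : X ⟶ Y) := regularMorphisms_iff_isIso_map hfin S hT f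
  have hW' : (regularMorphisms (FactorCategory T)).IsInvertedBy (homFunctor h) :=
    fun _ _ f hf => (hW f).1 hf
  exact ⟨_, isEquivalence_of_hasLiftableCovers (homFunctor h) L (hasLiftableCovers_homFunctor h hT)
    (Localization.lift _ hW' L) hW (Localization.fac _ hW' L)⟩

/-- A faithful functor to modules bounds the Hom types of the constructed localisation, which can
then be shrunk. -/
lemma nonempty_hasLocalization :
    Nonempty (MorphismProperty.HasLocalization.{v} (regularMorphisms (FactorCategory T))) := by
  let W := regularMorphisms (FactorCategory T)
  obtain ⟨G, _⟩ := exists_isEquivalence_fgModuleCat hfin S hT W.Q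
  have : LocallySmall.{v} W.Localization := locallySmall_of_faithful G
  have : (W.Q ⋙ (ShrinkHoms.equivalence W.Localization).functor).IsLocalization W :=
    Functor.IsLocalization.of_equivalence_target W.Q W _ (ShrinkHoms.equivalence _) (Iso.refl _)
  exact ⟨{ D := ShrinkHoms W.Localization
           L := W.Q ⋙ (ShrinkHoms.equivalence W.Localization).functor }⟩

lemma exists_abelian_of_isLocalization {D : Type*} [Category* D] (L : FactorCategory T ⥤ D)
    [L.IsLocalization (regularMorphisms (FactorCategory T))] :
    ∃ _ : Abelian D, L.Additive := by
  have := hfin.isNoetherianRing T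
  have := regularMorphisms_hasLeftCalculusOfFractions hfin S hT
  obtain ⟨G, _⟩ := exists_isEquivalence_fgModuleCat hfin S hT L
  -- Addition is taken from left fractions, so `L` is additive; `G` then transports finite products
  -- and abelianness.
  let := Localization.preadditive L (regularMorphisms (FactorCategory T))
  have hL := Localization.functor_additive L (regularMorphisms (FactorCategory T))
  have : HasFiniteProducts D := ⟨fun _ => Adjunction.hasLimitsOfShape_of_equivalence G⟩
  exact ⟨abelianOfEquivalence G, hL⟩

end Regular

end RigidLocalization

theorem theorem5p1 {k : Type w} [Field k]
    {C : Type u} [Category.{v} C] [Preadditive C] [HasZeroObject C]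
    [HasShift C ℤ] [∀ n : ℤ, (shiftFunctor C n).Additive] [Pretriangulated C] [IsTriangulated C]
    [Linear k C] [∀ n : ℤ, (shiftFunctor C n).Linear k]
    [EssentiallySmall.{v} C]
    (hfin : RigidLocalization.IsHomFinite k C)
    (hKS : RigidLocalization.IsKrullSchmidt C)
    (hSerre : Nonempty (RigidLocalization.SerreDuality k C))
    (T : C) (hT : RigidLocalization.IsRigid T) :
    (RigidLocalization.regularMorphisms
        (RigidLocalization.FactorCategory T)).HasLeftCalculusOfFractions ∧
    (RigidLocalization.regularMorphisms
        (RigidLocalization.FactorCategory T)).HasRightCalculusOfFractions ∧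
    Nonempty (MorphismProperty.HasLocalization.{v}
      (RigidLocalization.regularMorphisms (RigidLocalization.FactorCategory T))) ∧
    ∀ {D : Type u'} [Category.{v'} D] (L : RigidLocalization.FactorCategory T ⥤ D)
      [L.IsLocalization
        (RigidLocalization.regularMorphisms (RigidLocalization.FactorCategory T))],
      ∃ _ : Abelian D, L.Additive := by
  obtain ⟨S⟩ := hSerre
  open RigidLocalization in
  exact ⟨regularMorphisms_hasLeftCalculusOfFractions hfin S hT,
    regularMorphisms_hasRightCalculusOfFractions hfin S hT,
    nonempty_hasLocalization hfin S hT,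
    fun L => exists_abelian_of_isLocalization hfin S hT L⟩
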